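/- Let $d\ge 0$ be an integer, let $C\subset\mathbb{R}^d$ be closed and convex, and set $c(x,y)=|y-x|^2$ if $y-x\in C$ and $c(x,y)=+\infty$ otherwise, where $|\cdot|$ is the Euclidean norm. Let $f_0,f_1$ be Borel probability measures on $\mathbb{R}^d$, with $f_0$ absolutely continuous with respect to the Lebesgue measure, and let $\Pi(f_0,f_1)$ be the set of probability measures on $\mathbb{R}^d\times\mathbb{R}^d$ with marginals $f_0$ and $f_1$. For a convex set $K\subset\mathbb{R}^d$, a maximal flat part of $K$ is a set that is maximal for inclusion among the convex subsets of $K$ that have more than one point and are contained in the relative boundary of $K$ (its boundary in its affine span). A flat part of $K$ is a set $F$ for which there is a finite chain $F=F_1\subset F_2\subset\dots\subset F_k=K$, $k\ge 2$, such that $F_i$ is a maximal flat part of $F_{i+1}$ for each $i=1,\dots,k-1$. Assume that (i) there is $\pi\in\Pi(f_0,f_1)$ with $\int c(x,y)\,d\pi(x,y)<+\infty$; (ii) $C$ has at most countably many flat parts. Then the Kantorovich problem $$\min\Big\{\int_{\mathbb{R}^d\times\mathbb{R}^d} c(x,y)\,d\pi(x,y)\;:\;\pi\in\Pi(f_0,f_1)\Big\}$$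 has exactly one solution, and the Monge problem $$\min\Big\{\int_{\mathbb{R}^d} c(x,T(x))\,df_0(x)\;:\;T:\mathbb{R}^d\to\mathbb{R}^d\text{ Borel},\ T_\sharp f_0=f_1\Big\}$$ has a solution, and any two of its solutions are equal $f_0$-almost everywhere. -/

import Mathlib

open MeasureTheory
open scoped ENNReal

namespace ConstrainedOT

/-- The space `ℝ^d` with its Euclidean norm. -/
abbrev Space (d : ℕ) : Type := EuclideanSpace ℝ (Fin d)

open Classical in
/-- The quadratic cost with constraint `C`: `|y - x|^2` if `y - x ∈ C`, and `+∞` otherwise. -/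
noncomputable def cost {d : ℕ} (C : Set (Space d)) (x y : Space d) : ℝ≥0∞ :=
  if y - x ∈ C then ENNReal.ofReal (‖y - x‖ ^ 2) else ⊤

/-- `Π(f₀, f₁)`: the probability measures on `ℝ^d × ℝ^d` with marginals `f₀` and `f₁`. -/
def Plans {d : ℕ} (f₀ f₁ : Measure (Space d)) : Set (Measure (Space d × Space d)) :=
  {π | IsProbabilityMeasure π ∧ π.map Prod.fst = f₀ ∧ π.map Prod.snd = f₁}

/-- The maps `T` admissible in the Monge problem: Borel maps with `T_♯ f₀ = f₁`. -/
def Maps {d : ℕ} (f₀ f₁ : Measure (Space d)) : Set (Space d → Space d) :=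
  {T | Measurable T ∧ f₀.map T = f₁}

/-- The Kantorovich functional. -/
noncomputable def planCost {d : ℕ} (C : Set (Space d)) (π : Measure (Space d × Space d)) : ℝ≥0∞ :=
  ∫⁻ p, cost C p.1 p.2 ∂π

/-- The Monge functional. -/
noncomputable def mapCost {d : ℕ} (C : Set (Space d)) (f₀ : Measure (Space d))
    (T : Space d → Space d) : ℝ≥0∞ :=
  ∫⁻ x, cost C x (T x) ∂f₀

/-- `π` solves the Kantorovich problem: it is admissible and minimizes the cost. -/
def SolvesKantorovich {d : ℕ} (C : Set (Space d)) (f₀ f₁ : Measure (Space d))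
    (π : Measure (Space d × Space d)) : Prop :=
  π ∈ Plans f₀ f₁ ∧ IsMinOn (planCost C) (Plans f₀ f₁) π

/-- `T` solves the Monge problem: it is admissible and minimizes the cost. -/
def SolvesMonge {d : ℕ} (C : Set (Space d)) (f₀ f₁ : Measure (Space d))
    (T : Space d → Space d) : Prop :=
  T ∈ Maps f₀ f₁ ∧ IsMinOn (mapCost C f₀) (Maps f₀ f₁) T

/-- A straight part of `C`: a convex subset of `C` with more than one point that is contained in
the relative boundary of `C` (its boundary in its affine span). -/
def IsStraightPart {d : ℕ} (C F : Set (Space d)) : Prop :=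
  Convex ℝ F ∧ F.Nontrivial ∧ F ⊆ C ∧ F ⊆ intrinsicFrontier ℝ C

/-- A maximal flat part of `C`: a straight part that is maximal for inclusion. -/
def IsMaximalFlatPart {d : ℕ} (C F : Set (Space d)) : Prop :=
  Maximal (IsStraightPart C) F

/-- A flat part of `C`: a set `F` for which there is a finite chain `F = F₁ ⊂ ⋯ ⊂ F_k = C`,
`k ≥ 2`, in which each `F_i` is a maximal flat part of `F_{i+1}`. -/
def IsFlatPart {d : ℕ} (C F : Set (Space d)) : Prop :=
  Relation.TransGen (fun A B => IsMaximalFlatPart B A) F C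

end ConstrainedOT

/-! An optimal plan exists by weak compactness (`exists_solvesKantorovich`). Disintegrate it over
`f₀` with kernel `K`; the point is that almost every `K x` is a Dirac mass
(`SolvesKantorovich.exists_map`).

Suppose that `K x` charges targets near two distinct displacements `p` and `q`. Descending through
flat parts, whose dimension drops at each stage, gives `G` (equal to `C` or a flat part) containing
both, with their midpoint relatively interior (`exists_flatPart_midpoint_mem_intrinsicInterior`).
Take `v` close to `q - p`. A Steinhaus argument (`ae_frequently_add_smul_mem`) yields small `t > 0`
such that `x + t • v` also sends mass along displacements in `G` near `p`. Exchanging these targets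
with those of `x` near `q` turns displacements `p'`, `q'` into `p' + t • v`, `q' - t • v`. Both stay
in `G`, and the sum of squares strictly drops (`exists_direction_sq_norm_add_lt`), contradicting
two-point optimality (`SolvesKantorovich.ae_ae_cost_add_le`).

Countability of the flat parts lets the exceptional null sets be discarded for all `G` and a dense
supply of directions at once. Uniqueness follows by applying the graph property to the average of
two optimal plans. -/

namespace ConstrainedOT

open Set Module Filter Topology ProbabilityTheory

/-! ### Relative interior and relative boundary of convex sets -/

section Geometry

variable {E : Type*} [NormedAddCommGroup E] [NormedSpace ℝ E]

/-- A point is in the intrinsic interior iff the set contains a ball of the affine span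
around it. -/
lemma mem_intrinsicInterior_iff_ball {s : Set E} {x : E} :
    x ∈ intrinsicInterior ℝ s ↔
      x ∈ affineSpan ℝ s ∧ ∃ ε > 0, ∀ w ∈ affineSpan ℝ s, dist w x < ε → w ∈ s := by
  rw [mem_intrinsicInterior]
  constructor
  · rintro ⟨y, hy, rfl⟩
    obtain ⟨ε, hε, h⟩ := Metric.mem_nhds_iff.1 (mem_interior_iff_mem_nhds.1 hy)
    exact ⟨y.2, ε, hε, fun w hw hd => h (show (⟨w, hw⟩ : affineSpan ℝ s) ∈ Metric.ball y ε from hd)⟩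
  · rintro ⟨hx, ε, hε, h⟩
    refine ⟨⟨x, hx⟩, mem_interior_iff_mem_nhds.2 (Metric.mem_nhds_iff.2 ⟨ε, hε, ?_⟩), rfl⟩
    exact fun w hw => h w w.2 hw

lemma add_smul_sub_mem_affineSpan {s : Set E} {a b c : E} (t : ℝ) (ha : a ∈ affineSpan ℝ s)
    (hb : b ∈ affineSpan ℝ s) (hc : c ∈ affineSpan ℝ s) : a + t • (b - c) ∈ affineSpan ℝ s := by
  have := AffineSubspace.smul_vsub_vadd_mem (affineSpan ℝ s) t hb hc ha
  simpa [add_comm] using this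

/-- The homothety of centre `p` and ratio `a` carries a relative ball of radius `ε` about `r` to one
of radius `a * ε` about `m`. -/
lemma _root_.Convex.openSegment_subset_intrinsicInterior {s : Set E} (hs : Convex ℝ s) {r p m : E}
    (hr : r ∈ intrinsicInterior ℝ s) (hp : p ∈ s) (hm : m ∈ openSegment ℝ r p) :
    m ∈ intrinsicInterior ℝ s := by
  rw [mem_intrinsicInterior_iff_ball] at hr ⊢
  obtain ⟨hrA, ε, hε, h⟩ := hr
  obtain ⟨a, b, ha, hb, hab, rfl⟩ := hm
  have hpA : p ∈ affineSpan ℝ s := subset_affineSpan ℝ s hp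
  have hmA : a • r + b • p ∈ affineSpan ℝ s := by
    have := add_smul_sub_mem_affineSpan b hrA hpA hrA
    convert this using 1
    obtain rfl : a = 1 - b := by linarith
    module
  refine ⟨hmA, a * ε, by positivity, fun w hw hd => ?_⟩
  have h1 : r + a⁻¹ • (w - (a • r + b • p)) ∈ s := by
    refine h _ (add_smul_sub_mem_affineSpan _ hrA hw hmA) ?_
    rw [dist_eq_norm] at hd ⊢
    rw [add_sub_cancel_left, norm_smul, norm_inv, Real.norm_of_nonneg ha.le,
      inv_mul_lt_iff₀ ha]
    exact hd
  convert hs h1 hp ha.le hb.le hab using 1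
  rw [smul_add, smul_smul, mul_inv_cancel₀ ha.ne']
  module

lemma mem_intrinsicFrontier_of_notMem_intrinsicInterior {s : Set E} {x : E} (hx : x ∈ s)
    (h : x ∉ intrinsicInterior ℝ s) : x ∈ intrinsicFrontier ℝ s := by
  rw [← intrinsicClosure_sdiff_intrinsicInterior]
  exact ⟨subset_intrinsicClosure hx, h⟩

lemma notMem_intrinsicInterior_of_mem_intrinsicFrontier {s : Set E} {x : E}
    (h : x ∈ intrinsicFrontier ℝ s) : x ∉ intrinsicInterior ℝ s := by
  rw [← intrinsicClosure_sdiff_intrinsicInterior] at h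
  exact h.2

/-- If the midpoint of a segment of a convex set is not in the intrinsic interior, then the
whole segment is in the intrinsic frontier. -/
lemma _root_.Convex.segment_subset_intrinsicFrontier {s : Set E} (hs : Convex ℝ s) {p q : E}
    (hp : p ∈ s) (hq : q ∈ s) (hm : midpoint ℝ p q ∉ intrinsicInterior ℝ s) :
    segment ℝ p q ⊆ intrinsicFrontier ℝ s := by
  intro r hr
  refine mem_intrinsicFrontier_of_notMem_intrinsicInterior (hs.segment_subset hp hq hr) fun h => ?_
  obtain ⟨a, b, ha, hb, hab, rfl⟩ := hr
  have hmid : midpoint ℝ p q = (1 / 2 : ℝ) • p + (1 / 2 : ℝ) • q := by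
    rw [midpoint_eq_smul_add]; simp
  obtain rfl : b = 1 - a := by linarith
  -- If `r` were relatively interior, the midpoint, lying between `r` and the endpoint farther from
  -- it, would be too.
  rcases lt_trichotomy a (1 / 2) with h1 | h1 | h1
  · have h0 : 0 < 1 - a := by linarith
    refine hm (hs.openSegment_subset_intrinsicInterior h hp
      ⟨1 / (2 * (1 - a)), 1 - 1 / (2 * (1 - a)), by positivity, ?_, by ring, ?_⟩)
    · rw [sub_pos, div_lt_one (by linarith)]; linarith
    · have h2 : 1 - a ≠ 0 := by linarith
      rw [hmid]; match_scalars <;> field_simp; ring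
  · subst h1
    apply hm
    rw [hmid]
    convert h using 3; norm_num
  · refine hm (hs.openSegment_subset_intrinsicInterior h hq
      ⟨1 / (2 * a), 1 - 1 / (2 * a), by positivity, ?_, by ring, ?_⟩)
    · rw [sub_pos, div_lt_one (by linarith)]; linarith
    · have h2 : a ≠ 0 := by linarith
      rw [hmid]; match_scalars <;> field_simp; ring

/-- A convex subset of the intrinsic frontier spans a proper affine subspace. -/
lemma finrank_direction_lt_of_subset_intrinsicFrontier [FiniteDimensional ℝ E] {s t : Set E}
    (ht : Convex ℝ t) (hne : t.Nonempty) (hts : t ⊆ s) (h : t ⊆ intrinsicFrontier ℝ s) :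
    finrank ℝ (affineSpan ℝ t).direction < finrank ℝ (affineSpan ℝ s).direction := by
  have hle : affineSpan ℝ t ≤ affineSpan ℝ s := affineSpan_mono ℝ hts
  refine Submodule.finrank_lt_finrank_of_lt
    (lt_of_le_of_ne (AffineSubspace.direction_le hle) fun heq => ?_)
  have hspan : affineSpan ℝ t = affineSpan ℝ s :=
    AffineSubspace.eq_of_direction_eq_of_nonempty_of_le heq
      (hne.mono (subset_affineSpan ℝ t)) hle
  obtain ⟨x, hx⟩ := hne.intrinsicInterior ht
  refine notMem_intrinsicInterior_of_mem_intrinsicFrontier (h (intrinsicInterior_subset hx)) ?_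
  rw [mem_intrinsicInterior_iff_ball] at hx ⊢
  rw [← hspan]
  exact ⟨hx.1, hx.2.imp fun ε hε => ⟨hε.1, fun w hw hd => hts (hε.2 w hw hd)⟩⟩

end Geometry

variable {d : ℕ}

/-! ### Flat parts of a closed convex set -/

lemma IsStraightPart.exists_isMaximalFlatPart {C A : Set (Space d)} (hA : IsStraightPart C A) :
    ∃ F, A ⊆ F ∧ IsMaximalFlatPart C F := by
  refine zorn_subset_nonempty {F | IsStraightPart C F} (fun c hc hchain hne => ?_) A hA
  refine ⟨⋃₀ c, ⟨?_, ?_, ?_, ?_⟩, fun s hs => subset_sUnion_of_mem hs⟩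
  · exact hchain.directedOn.convex_sUnion fun F hF => (hc hF).1
  · obtain ⟨F, hF⟩ := hne
    exact (hc hF).2.1.mono (subset_sUnion_of_mem hF)
  · exact sUnion_subset fun F hF => (hc hF).2.2.1
  · exact sUnion_subset fun F hF => (hc hF).2.2.2

/-- The closure is again a straight part, so maximality absorbs it. -/
lemma IsMaximalFlatPart.isClosed {C F : Set (Space d)} (hC : IsClosed C)
    (hF : IsMaximalFlatPart C F) : IsClosed F := by
  have hfr : IsClosed (intrinsicFrontier ℝ C) :=
    isClosed_intrinsicFrontier (AffineSubspace.closed_of_finiteDimensional _)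
  obtain ⟨h1, h2, h3, h4⟩ := hF.prop
  have : IsStraightPart C (closure F) :=
    ⟨h1.closure, h2.mono subset_closure, closure_minimal h3 hC, closure_minimal h4 hfr⟩
  exact isClosed_of_closure_subset (hF.le_of_ge this subset_closure)

/-- Two distinct points of a closed convex set lie in the set itself or in one of its flat parts,
with their midpoint in the intrinsic interior of it. -/
lemma exists_flatPart_midpoint_mem_intrinsicInterior {C : Set (Space d)} (hC : IsClosed C)
    (hconv : Convex ℝ C) {p q : Space d} (hp : p ∈ C) (hq : q ∈ C) (hpq : p ≠ q) :
    ∃ G, (G = C ∨ IsFlatPart C G) ∧ p ∈ G ∧ q ∈ G ∧ midpoint ℝ p q ∈ intrinsicInterior ℝ G := by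
  induction hn : finrank ℝ (affineSpan ℝ C).direction using Nat.strong_induction_on generalizing C
    with
  | _ n ih =>
    by_cases hm : midpoint ℝ p q ∈ intrinsicInterior ℝ C
    · exact ⟨C, Or.inl rfl, hp, hq, hm⟩
    have hstr : IsStraightPart C (segment ℝ p q) :=
      ⟨convex_segment p q, ⟨p, left_mem_segment ℝ p q, q, right_mem_segment ℝ p q, hpq⟩,
        hconv.segment_subset hp hq, hconv.segment_subset_intrinsicFrontier hp hq hm⟩
    obtain ⟨F, hsF, hF⟩ := hstr.exists_isMaximalFlatPart
    obtain ⟨G, hG, h⟩ := ih _ (hn ▸ finrank_direction_lt_of_subset_intrinsicFrontier hF.prop.1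
      hF.prop.2.1.nonempty hF.prop.2.2.1 hF.prop.2.2.2) (hF.isClosed hC) hF.prop.1
      (hsF (left_mem_segment ℝ p q)) (hsF (right_mem_segment ℝ p q)) rfl
    refine ⟨G, Or.inr ?_, h⟩
    rcases hG with rfl | hG
    · exact Relation.TransGen.single hF
    · exact Relation.TransGen.tail hG hF

lemma IsFlatPart.isClosed_convex_subset {C F : Set (Space d)} (hC : IsClosed C)
    (hF : IsFlatPart C F) : IsClosed F ∧ Convex ℝ F ∧ F ⊆ C := by
  induction hF using Relation.TransGen.head_induction_on with
  | single h => exact ⟨h.isClosed hC, h.prop.1, h.prop.2.2.1⟩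
  | head h _ ih => exact ⟨h.isClosed ih.1, h.prop.1, h.prop.2.2.1.trans ih.2.2⟩

lemma measurable_cost {C : Set (Space d)} (hC : IsClosed C) :
    Measurable fun p : Space d × Space d => cost C p.1 p.2 := by
  unfold cost
  exact Measurable.ite (hC.measurableSet.preimage (by fun_prop)) (by fun_prop) measurable_const

/-! ### Existence of an optimal plan -/

section Existence

/-- Bounded continuous functions increasing to the constrained cost. -/
noncomputable def costApprox (C : Set (Space d)) (n : ℕ) (p : Space d × Space d) : NNReal :=
  min n (Real.toNNReal (‖p.2 - p.1‖ ^ 2 + n * Metric.infDist (p.2 - p.1) C))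

lemma continuous_costApprox (C : Set (Space d)) (n : ℕ) : Continuous (costApprox C n) := by
  unfold costApprox
  have : Continuous fun p : Space d × Space d => Metric.infDist (p.2 - p.1) C :=
    (Metric.continuous_infDist_pt C).comp (by fun_prop)
  fun_prop

lemma monotone_costApprox (C : Set (Space d)) : Monotone (costApprox C) := by
  intro m n hmn p
  have : (m : ℝ) ≤ n := by exact_mod_cast hmn
  unfold costApprox
  refine min_le_min (by exact_mod_cast hmn) (Real.toNNReal_le_toNNReal ?_)
  gcongr
  exact Metric.infDist_nonneg

/-- Off `C` the distance is positive because `C` is closed, so the penalty diverges. Nonemptiness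
matters: `Metric.infDist` to the empty set is `0`. -/
lemma iSup_costApprox {C : Set (Space d)} (hC : IsClosed C) (hne : C.Nonempty)
    (p : Space d × Space d) : ⨆ n, (costApprox C n p : ℝ≥0∞) = cost C p.1 p.2 := by
  refine iSup_eq_of_forall_le_of_forall_lt_exists_gt (fun n => ?_) (fun w hw => ?_)
  · unfold cost costApprox
    split_ifs with h
    · rw [Metric.infDist_zero_of_mem h, mul_zero, add_zero]
      exact ENNReal.coe_le_coe.2 (min_le_right _ _)
    · exact le_top
  · lift w to NNReal using (hw.trans_le le_top).ne
    unfold cost at hw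
    unfold costApprox
    simp only [ENNReal.coe_lt_coe, lt_min_iff]
    split_ifs at hw with h
    · obtain ⟨n, hn⟩ := exists_nat_gt w
      rw [Metric.infDist_zero_of_mem h]
      refine ⟨n, hn, ?_⟩
      rw [mul_zero, add_zero]
      exact ENNReal.coe_lt_coe.1 hw
    · have hpos : 0 < Metric.infDist (p.2 - p.1) C := (hC.notMem_iff_infDist_pos hne).1 h
      obtain ⟨n, hn⟩ := exists_nat_gt (max (w : ℝ) (w / Metric.infDist (p.2 - p.1) C))
      refine ⟨n, by exact_mod_cast (le_max_left _ _).trans_lt hn, ?_⟩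
      have h2 := (le_max_right _ _).trans_lt hn
      rw [div_lt_iff₀ hpos] at h2
      rw [Real.lt_toNNReal_iff_coe_lt]
      have := sq_nonneg ‖p.2 - p.1‖
      linarith

/-- By monotone convergence the cost is a supremum of weakly continuous functionals. -/
lemma lowerSemicontinuous_planCost {C : Set (Space d)} (hC : IsClosed C) (hne : C.Nonempty) :
    LowerSemicontinuous fun π : ProbabilityMeasure (Space d × Space d) =>
      planCost C (π : Measure (Space d × Space d)) := by
  have h1 (π : ProbabilityMeasure (Space d × Space d)) :
      planCost C (π : Measure (Space d × Space d)) =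
        ⨆ n, ∫⁻ p, (costApprox C n p : ℝ≥0∞) ∂(π : Measure (Space d × Space d)) := by
    rw [← lintegral_iSup (fun n => (continuous_costApprox C n).measurable.coe_nnreal_ennreal)
      (fun m n h p => ENNReal.coe_le_coe.2 (monotone_costApprox C h p))]
    simp only [planCost, iSup_costApprox hC hne]
  simp only [h1]
  refine lowerSemicontinuous_iSup fun n => Continuous.lowerSemicontinuous ?_
  let f : BoundedContinuousFunction (Space d × Space d) NNReal :=
    BoundedContinuousFunction.mkOfBound ⟨costApprox C n, continuous_costApprox C n⟩ n fun p q => by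
      have hb (r : Space d × Space d) : (costApprox C n r : ℝ) ≤ n := by
        exact_mod_cast min_le_left _ _
      have hb' (r : Space d × Space d) : (0 : ℝ) ≤ costApprox C n r := NNReal.coe_nonneg _
      simp only [ContinuousMap.coe_mk, NNReal.dist_eq]
      rw [abs_le]
      constructor <;> linarith [hb p, hb q, hb' p, hb' q]
  have := ENNReal.continuous_coe.comp (ProbabilityMeasure.continuous_testAgainstNN_eval f)
  convert this using 2 with π
  simp [f]

/-- The direct method: fixed marginals make the plans tight, hence compact by Prokhorov's theorem.
-/
lemma exists_solvesKantorovich {C : Set (Space d)} (hC : IsClosed C)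
    (f₀ f₁ : Measure (Space d)) [IsProbabilityMeasure f₀] [IsProbabilityMeasure f₁]
    (hfinite : ∃ π ∈ Plans f₀ f₁, planCost C π < ⊤) :
    ∃ π, SolvesKantorovich C f₀ f₁ π ∧ planCost C π < ⊤ := by
  obtain ⟨π₀, hπ₀, hcost⟩ := hfinite
  have := hπ₀.1
  have hne : C.Nonempty := by
    rw [nonempty_iff_ne_empty]
    rintro rfl
    simp [planCost, cost] at hcost
  let S : Set (ProbabilityMeasure (Space d × Space d)) := {π | (π : Measure _) ∈ Plans f₀ f₁}
  have hS : IsTightMeasureSet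
      {((π : ProbabilityMeasure (Space d × Space d)) : Measure (Space d × Space d)) | π ∈ S} := by
    refine IsTightMeasureSet.prodMk
      ((isTightMeasureSet_singleton (μ := f₀)).subset ?_)
      ((isTightMeasureSet_singleton (μ := f₁)).subset ?_)
    · rintro _ ⟨_, ⟨π, hπ, rfl⟩, rfl⟩
      exact hπ.2.1
    · rintro _ ⟨_, ⟨π, hπ, rfl⟩, rfl⟩
      exact hπ.2.2
  have hclosed : IsClosed S := by
    have hS' : S = (fun π => π.map (f := Prod.fst) measurable_fst.aemeasurable) ⁻¹' {⟨f₀, ‹_›⟩} ∩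
        (fun π => π.map (f := Prod.snd) measurable_snd.aemeasurable) ⁻¹' {⟨f₁, ‹_›⟩} := by
      ext π
      exact ⟨fun h => ⟨Subtype.ext h.2.1, Subtype.ext h.2.2⟩, fun h =>
        ⟨inferInstance, congrArg Subtype.val h.1, congrArg Subtype.val h.2⟩⟩
    rw [hS']
    exact (isClosed_singleton.preimage (ProbabilityMeasure.continuous_map continuous_fst)).inter
      (isClosed_singleton.preimage (ProbabilityMeasure.continuous_map continuous_snd))
  have hcomp : IsCompact S := hclosed.closure_eq ▸ isCompact_closure_of_isTightMeasureSet hS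
  obtain ⟨π, hπ, hmin⟩ := LowerSemicontinuousOn.exists_isMinOn (s := S) ⟨⟨π₀, this⟩, hπ₀⟩ hcomp
    ((lowerSemicontinuous_planCost hC hne).lowerSemicontinuousOn S)
  have hmin' : IsMinOn (planCost C) (Plans f₀ f₁) π := fun π' hπ' =>
    hmin (show (⟨π', hπ'.1⟩ : ProbabilityMeasure _) ∈ S from hπ')
  exact ⟨π, ⟨hπ, hmin'⟩, (hmin' hπ₀).trans_lt hcost⟩

end Existence

/-! ### Two-point optimality and recurrence under small translations -/

/-- Two-point monotonicity of an optimal plan, along any coupling of it with itself. -/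
lemma SolvesKantorovich.ae_cost_add_le {C : Set (Space d)} (hC : IsClosed C)
    {f₀ f₁ : Measure (Space d)} {π : Measure (Space d × Space d)}
    (hπ : SolvesKantorovich C f₀ f₁ π) (hfin : planCost C π < ⊤)
    {κ : Measure ((Space d × Space d) × (Space d × Space d))}
    (h1 : κ.map Prod.fst ≤ π) (h2 : κ.map Prod.snd ≤ π) :
    ∀ᵐ w ∂κ, cost C w.1.1 w.1.2 + cost C w.2.1 w.2.2 ≤ cost C w.1.1 w.2.2 + cost C w.2.1 w.1.2 := by
  have hprob : IsProbabilityMeasure π := hπ.1.1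
  have hc := measurable_cost hC
  let g : (Space d × Space d) × (Space d × Space d) → ℝ≥0∞ := fun w =>
    cost C w.1.1 w.1.2 + cost C w.2.1 w.2.2
  let g' : (Space d × Space d) × (Space d × Space d) → ℝ≥0∞ := fun w =>
    cost C w.1.1 w.2.2 + cost C w.2.1 w.1.2
  have hg : Measurable g := (hc.comp measurable_fst).add (hc.comp measurable_snd)
  have hm1 : Measurable fun w : (Space d × Space d) × (Space d × Space d) => (w.1.1, w.2.2) := by
    fun_prop
  have hm2 : Measurable fun w : (Space d × Space d) × (Space d × Space d) => (w.2.1, w.1.2) := by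
    fun_prop
  have hg' : Measurable g' := (hc.comp hm1).add (hc.comp hm2)
  have hc1 : Measurable fun w : (Space d × Space d) × (Space d × Space d) => cost C w.1.1 w.1.2 :=
    hc.comp measurable_fst
  have hc2 : Measurable fun w : (Space d × Space d) × (Space d × Space d) => cost C w.1.1 w.2.2 :=
    hc.comp hm1
  have hB : MeasurableSet {w | g' w < g w} := measurableSet_lt hg' hg
  -- The factor one half makes the two marginals of `k` sum to at most `π`, so that mass can be
  -- removed from `π` and put back with targets exchanged.
  set k : Measure ((Space d × Space d) × (Space d × Space d)) :=
    (2⁻¹ : ℝ≥0∞) • κ.restrict {w | g' w < g w} with hk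
  have hk1 : k.map Prod.fst ≤ (2⁻¹ : ℝ≥0∞) • π := by
    rw [hk, Measure.map_smul]
    gcongr
    exact (Measure.map_mono Measure.restrict_le_self measurable_fst).trans h1
  have hk2 : k.map Prod.snd ≤ (2⁻¹ : ℝ≥0∞) • π := by
    rw [hk, Measure.map_smul]
    gcongr
    exact (Measure.map_mono Measure.restrict_le_self measurable_snd).trans h2
  set ν : Measure (Space d × Space d) := k.map Prod.fst + k.map Prod.snd with hν
  have hνπ : ν ≤ π := by
    calc ν ≤ (2⁻¹ : ℝ≥0∞) • π + (2⁻¹ : ℝ≥0∞) • π := add_le_add hk1 hk2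
      _ = π := by rw [← add_smul, ENNReal.inv_two_add_inv_two, one_smul]
  have : IsFiniteMeasure ν := ⟨(hνπ univ).trans_lt (measure_lt_top π univ)⟩
  have hsub : π - ν + ν = π := Measure.sub_add_cancel_of_le hνπ
  set π' : Measure (Space d × Space d) :=
    π - ν + (k.map (fun w => (w.1.1, w.2.2)) + k.map (fun w => (w.2.1, w.1.2))) with hπ'
  have hfst : π'.map Prod.fst = f₀ := by
    rw [← hπ.1.2.1]
    conv_rhs => rw [← hsub]
    rw [hπ', hν]
    simp only [Measure.map_add _ _ measurable_fst, Measure.map_map measurable_fst hm1,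
      Measure.map_map measurable_fst hm2, Measure.map_map measurable_fst measurable_fst,
      Measure.map_map measurable_fst measurable_snd]
    rfl
  have hsnd : π'.map Prod.snd = f₁ := by
    rw [← hπ.1.2.2]
    conv_rhs => rw [← hsub]
    rw [hπ', hν]
    simp only [Measure.map_add _ _ measurable_snd, Measure.map_map measurable_snd hm1,
      Measure.map_map measurable_snd hm2, Measure.map_map measurable_snd measurable_fst,
      Measure.map_map measurable_snd measurable_snd]
    exact congrArg _ (add_comm _ _)
  have hπ'prob : IsProbabilityMeasure π' := by
    constructor
    rw [← preimage_univ (f := Prod.fst), ← Measure.map_apply measurable_fst MeasurableSet.univ,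
      hfst, ← hπ.1.2.1, Measure.map_apply measurable_fst MeasurableSet.univ, preimage_univ,
      measure_univ]
  have hle : planCost C π ≤ planCost C π' := hπ.2 ⟨hπ'prob, hfst, hsnd⟩
  have e1 : planCost C π = planCost C (π - ν) + ∫⁻ w, g w ∂k := by
    conv_lhs => rw [← hsub, hν]
    simp only [planCost, lintegral_add_measure]
    rw [lintegral_map hc measurable_fst, lintegral_map hc measurable_snd,
      ← lintegral_add_left hc1]
  have e2 : planCost C π' = planCost C (π - ν) + ∫⁻ w, g' w ∂k := by
    simp only [planCost, hπ', lintegral_add_measure]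
    rw [lintegral_map hc hm1, lintegral_map hc hm2,
      ← lintegral_add_left hc2]
  rw [e1] at hfin
  -- Finite cost permits cancelling the untouched part `π - ν`.
  rw [e1, e2, ENNReal.add_le_add_iff_left (ENNReal.add_lt_top.1 hfin).1.ne] at hle
  have hkB : ∀ᵐ w ∂k, g' w < g w :=
    (Measure.ae_smul_measure (ae_restrict_mem hB) _ )
  have hk0 : k = 0 := by
    by_contra hne
    refine hle.not_gt (lintegral_strict_mono hne hg.aemeasurable ?_ hkB)
    exact (hle.antisymm (lintegral_mono_ae (hkB.mono fun w hw => hw.le))) ▸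
      (ENNReal.add_lt_top.1 hfin).2.ne
  have : κ {w | g' w < g w} = 0 := by
    have h3 : k univ = 0 := by rw [hk0]; simp
    simpa [hk] using h3
  rw [ae_iff]
  simpa only [not_le] using this

/-- For a fixed vector `v`, almost every point of a measurable set is sent back to the set by
arbitrarily small positive multiples of `v`. -/
lemma ae_frequently_add_smul_mem {S : Set (Space d)} (hS : MeasurableSet S) (v : Space d) :
    ∀ᵐ x, x ∈ S → ∃ᶠ n : ℕ in atTop, x + (1 / ((n : ℝ) + 1)) • v ∈ S := by
  let N : ℕ → Set (Space d) := fun m =>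
    S ∩ ⋂ n : ℕ, {x | m ≤ n → x + (1 / ((n : ℝ) + 1)) • v ∉ S}
  have hN (m : ℕ) : MeasurableSet (N m) := by
    refine hS.inter (MeasurableSet.iInter fun n => ?_)
    by_cases h : m ≤ n
    · simp only [h, forall_const]
      exact (hS.preimage (measurable_id.add_const _)).compl
    · simp [h]
  have hN0 (m : ℕ) : volume (N m) = 0 := by
    by_contra hne
    -- Steinhaus: `N m - N m` would contain a small multiple of `v` that the definition of `N m`
    -- forbids.
    have hnhds := Measure.sub_mem_nhds_zero_of_addHaar_pos volume (N m) (hN m)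
      (pos_iff_ne_zero.2 hne)
    have ht : Tendsto (fun n : ℕ => (1 / ((n : ℝ) + 1)) • v) atTop (𝓝 0) := by
      simpa using (tendsto_one_div_add_atTop_nhds_zero_nat (𝕜 := ℝ)).smul_const v
    obtain ⟨n, hn, hmn⟩ := ((ht.eventually hnhds).and (eventually_ge_atTop m)).exists
    obtain ⟨x', hx', x, hx, hxx⟩ := hn
    refine mem_iInter.1 hx.2 n hmn ?_
    rw [← hxx]
    simpa using hx'.1
  have : ∀ᵐ x, ∀ m, x ∉ N m := ae_all_iff.2 fun m => measure_eq_zero_iff_ae_notMem.1 (hN0 m)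
  filter_upwards [this] with x hx hxS
  rw [frequently_atTop]
  intro m
  by_contra! h
  exact hx m ⟨hxS, mem_iInter.2 fun n hn => h n hn⟩

/-- Along a fixed translation `v`, the conditional measures of an optimal plan satisfy two-point
monotonicity. -/
lemma SolvesKantorovich.ae_ae_cost_add_le {C : Set (Space d)} (hC : IsClosed C)
    {f₀ f₁ : Measure (Space d)} {π : Measure (Space d × Space d)}
    (hπ : SolvesKantorovich C f₀ f₁ π) (hfin : planCost C π < ⊤)
    {ρ : Space d → ℝ≥0∞} (hρ : Measurable ρ) {K : Kernel (Space d) (Space d)} [IsMarkovKernel K]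
    (hK : π = (volume.withDensity ρ).compProd K) (v : Space d) :
    ∀ᵐ x, min (ρ x) (ρ (x + v)) ≠ 0 → ∀ᵐ y ∂(K x).prod (K (x + v)),
      cost C x y.1 + cost C (x + v) y.2 ≤ cost C x y.2 + cost C (x + v) y.1 := by
  have hadd : Measurable fun x : Space d => x + v := measurable_id.add_const v
  -- This density is dominated at both `x` and `x + v`, so both marginals of the coupling are at
  -- most `π`; the second bound uses translation invariance of Lebesgue measure.
  set m : Space d → ℝ≥0∞ := fun x => min (ρ x) (ρ (x + v))
  have hmm : Measurable m := hρ.min (hρ.comp hadd)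
  set L : Kernel (Space d) (Space d × Space d) := K ×ₖ K.comap _ hadd with hL
  have hLx (x : Space d) : L x = (K x).prod (K (x + v)) := by
    rw [hL, Kernel.prod_apply, Kernel.comap_apply]
  set Φ : Space d × (Space d × Space d) → (Space d × Space d) × (Space d × Space d) :=
    fun w => ((w.1, w.2.1), (w.1 + v, w.2.2)) with hΦ
  have hΦm : Measurable Φ := by fun_prop
  have hπapply {s : Set (Space d × Space d)} (hs : MeasurableSet s) :
      π s = ∫⁻ x, ρ x * K x (Prod.mk x ⁻¹' s) := by
    rw [hK, Measure.compProd_apply hs, lintegral_withDensity_eq_lintegral_mul _ hρ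
      (Kernel.measurable_kernel_prodMk_left hs)]
    rfl
  have hκapply {t : Set (Space d × (Space d × Space d))} (ht : MeasurableSet t) :
      (volume.withDensity m).compProd L t = ∫⁻ x, m x * L x (Prod.mk x ⁻¹' t) := by
    rw [Measure.compProd_apply ht, lintegral_withDensity_eq_lintegral_mul _ hmm
      (Kernel.measurable_kernel_prodMk_left ht)]
    rfl
  have h1 : (((volume.withDensity m).compProd L).map Φ).map Prod.fst ≤ π := by
    refine Measure.le_iff.2 fun s hs => ?_
    rw [Measure.map_map measurable_fst hΦm,
      Measure.map_apply (measurable_fst.comp hΦm) hs,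
      hκapply (hs.preimage (measurable_fst.comp hΦm)), hπapply hs]
    refine lintegral_mono fun x => ?_
    have : Prod.mk x ⁻¹' (Prod.fst ∘ Φ ⁻¹' s) = (Prod.mk x ⁻¹' s) ×ˢ univ := by
      ext ⟨a, b⟩; simp [Φ]
    simp only [this, hLx, Measure.prod_prod, measure_univ, mul_one]
    gcongr
    exact min_le_left _ _
  have h2 : (((volume.withDensity m).compProd L).map Φ).map Prod.snd ≤ π := by
    refine Measure.le_iff.2 fun s hs => ?_
    rw [Measure.map_map measurable_snd hΦm,
      Measure.map_apply (measurable_snd.comp hΦm) hs,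
      hκapply (hs.preimage (measurable_snd.comp hΦm)), hπapply hs,
      ← lintegral_add_right_eq_self (fun x => ρ x * K x (Prod.mk x ⁻¹' s)) v]
    refine lintegral_mono fun x => ?_
    have : Prod.mk x ⁻¹' (Prod.snd ∘ Φ ⁻¹' s) = univ ×ˢ (Prod.mk (x + v) ⁻¹' s) := by
      ext ⟨a, b⟩; simp [Φ]
    simp only [this, hLx, Measure.prod_prod, measure_univ, one_mul]
    gcongr
    exact min_le_right _ _
  have hae := ae_of_ae_map hΦm.aemeasurable (hπ.ae_cost_add_le hC hfin h1 h2)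
  have hae2 := Measure.ae_ae_of_ae_compProd hae
  rw [ae_withDensity_iff hmm] at hae2
  filter_upwards [hae2] with x hx hx0
  have := hx hx0
  rwa [hLx] at this

/-! ### Optimal plans are concentrated on graphs -/

/-- If the midpoint of `p` and `q` is intrinsically interior to `G`, then small exchanges of
displacements near `p` and `q` along a suitable direction stay in `G` and decrease the
quadratic cost. -/
lemma exists_direction_sq_norm_add_lt {G D : Set (Space d)} (hG : Convex ℝ G) (hDG : D ⊆ G)
    (hD : G ⊆ closure D) {p q : Space d} (hp : p ∈ G) (hq : q ∈ G) (hpq : p ≠ q)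
    (hmid : midpoint ℝ p q ∈ intrinsicInterior ℝ G) :
    ∃ a ∈ D, ∃ b ∈ D, ∃ δ > (0 : ℝ), ∃ τ > (0 : ℝ), ∀ t, 0 < t → t < τ → ∀ p' ∈ G, ∀ q' ∈ G,
      dist p' p < δ → dist q' q < δ → p' + t • (b - a) ∈ G ∧ q' - t • (b - a) ∈ G ∧
        ‖p' + t • (b - a)‖ ^ 2 + ‖q' - t • (b - a)‖ ^ 2 < ‖p'‖ ^ 2 + ‖q'‖ ^ 2 := by
  obtain ⟨-, ε, hε, hball⟩ := mem_intrinsicInterior_iff_ball.1 hmid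
  have hr : 0 < ‖q - p‖ := norm_pos_iff.2 (sub_ne_zero.2 hpq.symm)
  -- The first bound keeps half-step exchanges within `ε` of the midpoint, hence in `G`; the second
  -- keeps the inner product of `q' - p'` and `b - a` at least `‖q - p‖ ^ 2 / 2`.
  set δ : ℝ := min (ε / 2) (‖q - p‖ / 16) with hδ
  have hδ0 : 0 < δ := by positivity
  have hδε : δ ≤ ε / 2 := min_le_left _ _
  have hδr : δ ≤ ‖q - p‖ / 16 := min_le_right _ _
  obtain ⟨a, haD, ha⟩ := Metric.mem_closure_iff.1 (hD hp) δ hδ0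
  obtain ⟨b, hbD, hb⟩ := Metric.mem_closure_iff.1 (hD hq) δ hδ0
  refine ⟨a, haD, b, hbD, δ, hδ0, min (1 / 2) (‖q - p‖ ^ 2 / 4 / (‖b - a‖ ^ 2 + 1)), by positivity,
    fun t ht0 ht p' hp' q' hq' hpp hqq => ?_⟩
  rw [dist_comm, dist_eq_norm] at ha hb
  rw [dist_eq_norm] at hpp hqq
  have ht2 : t < 1 / 2 := ht.trans_le (min_le_left _ _)
  have htv : t * ‖b - a‖ ^ 2 < ‖q - p‖ ^ 2 / 4 := by
    have := ht.trans_le (min_le_right _ _)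
    rw [lt_div_iff₀ (by positivity)] at this
    linarith
  have hmidp : midpoint ℝ p q = (1 / 2 : ℝ) • p + (1 / 2 : ℝ) • q := by
    rw [midpoint_eq_smul_add]; simp
  have hmem {z : Space d} (hz : z ∈ G) : z ∈ affineSpan ℝ G := subset_affineSpan ℝ G hz
  have hp1 : p' + (1 / 2 : ℝ) • (b - a) ∈ G := by
    refine hball _ (add_smul_sub_mem_affineSpan _ (hmem hp') (hmem (hDG hbD)) (hmem (hDG haD))) ?_
    rw [dist_eq_norm, hmidp]
    calc _ = ‖(p' - p) + (1 / 2 : ℝ) • ((b - q) - (a - p))‖ := by congr 1; module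
      _ ≤ ‖p' - p‖ + 1 / 2 * (‖b - q‖ + ‖a - p‖) := by
        refine (norm_add_le _ _).trans ?_
        rw [norm_smul, Real.norm_of_nonneg (by norm_num)]
        gcongr
        exact norm_sub_le _ _
      _ < ε := by linarith
  have hq1 : q' + (1 / 2 : ℝ) • (a - b) ∈ G := by
    refine hball _ (add_smul_sub_mem_affineSpan _ (hmem hq') (hmem (hDG haD)) (hmem (hDG hbD))) ?_
    rw [dist_eq_norm, hmidp]
    calc _ = ‖(q' - q) + (1 / 2 : ℝ) • ((a - p) - (b - q))‖ := by congr 1; module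
      _ ≤ ‖q' - q‖ + 1 / 2 * (‖a - p‖ + ‖b - q‖) := by
        refine (norm_add_le _ _).trans ?_
        rw [norm_smul, Real.norm_of_nonneg (by norm_num)]
        gcongr
        exact norm_sub_le _ _
      _ < ε := by linarith
  refine ⟨?_, ?_, ?_⟩
  · convert hG hp' hp1 (a := 1 - 2 * t) (b := 2 * t) (by linarith) (by linarith) (by ring) using 1
    module
  · convert hG hq' hq1 (a := 1 - 2 * t) (b := 2 * t) (by linarith) (by linarith) (by ring) using 1
    module
  · have hinner : ‖q - p‖ ^ 2 / 2 ≤ inner ℝ (q' - p') (b - a) := by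
      have e1 : q' - p' = (q - p) + ((q' - q) - (p' - p)) := by abel
      have e2 : b - a = (q - p) + ((b - q) - (a - p)) := by abel
      have n1 : ‖(q' - q) - (p' - p)‖ ≤ ‖q - p‖ / 8 := (norm_sub_le _ _).trans (by linarith)
      have n2 : ‖(b - q) - (a - p)‖ ≤ ‖q - p‖ / 8 := (norm_sub_le _ _).trans (by linarith)
      rw [e1, e2]
      set w := q - p
      set u := (q' - q) - (p' - p)
      set z := (b - q) - (a - p)
      rw [inner_add_left, inner_add_right, inner_add_right, real_inner_self_eq_norm_sq]
      have i1 := neg_le_of_abs_le (abs_real_inner_le_norm w z)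
      have i2 := neg_le_of_abs_le (abs_real_inner_le_norm u w)
      have i3 := neg_le_of_abs_le (abs_real_inner_le_norm u z)
      have j1 : ‖w‖ * ‖z‖ ≤ ‖w‖ * (‖w‖ / 8) := by gcongr
      have j2 : ‖u‖ * ‖w‖ ≤ ‖w‖ / 8 * ‖w‖ := by gcongr
      have j3 : ‖u‖ * ‖z‖ ≤ ‖w‖ / 8 * (‖w‖ / 8) := by gcongr
      nlinarith [sq_nonneg ‖w‖]
    rw [norm_add_sq_real, norm_sub_sq_real, norm_smul, Real.norm_of_nonneg ht0.le,
      inner_smul_right, inner_smul_right]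
    rw [inner_sub_left] at hinner
    have h3 : t * (inner ℝ p' (b - a) - inner ℝ q' (b - a) + t * ‖b - a‖ ^ 2) < 0 :=
      mul_neg_of_pos_of_neg ht0 (by linarith [sq_pos_of_pos hr])
    nlinarith

/-- An optimal plan is concentrated on the graph of a Borel map. -/
lemma SolvesKantorovich.exists_map {C : Set (Space d)} (hC : IsClosed C) (hconv : Convex ℝ C)
    {f₀ f₁ : Measure (Space d)} [IsProbabilityMeasure f₀] (hf₀ : f₀ ≪ volume)
    (hflat : {F | IsFlatPart C F}.Countable) {π : Measure (Space d × Space d)}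
    (hπ : SolvesKantorovich C f₀ f₁ π) (hfin : planCost C π < ⊤) :
    ∃ T : Space d → Space d, Measurable T ∧ ∀ᵐ p ∂π, p.2 = T p.1 := by
  have hprob : IsProbabilityMeasure π := hπ.1.1
  have hfst : π.fst = f₀ := hπ.1.2.1
  set K : Kernel (Space d) (Space d) := π.condKernel
  set ρ : Space d → ℝ≥0∞ := f₀.rnDeriv volume
  have hρ : Measurable ρ := Measure.measurable_rnDeriv _ _
  have hρf : volume.withDensity ρ = f₀ := Measure.withDensity_rnDeriv_eq _ _ hf₀
  have hK : π = (volume.withDensity ρ).compProd K := by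
    rw [hρf, ← hfst]
    exact (π.disintegrate π.condKernel).symm
  have hK' : π = f₀.compProd K := by rw [← hρf, ← hK]
  -- the countable families of sets and directions
  let 𝒢 : Set (Set (Space d)) := insert C {F | IsFlatPart C F}
  have h𝒢 : 𝒢.Countable := hflat.insert C
  have h𝒢' : ∀ G ∈ 𝒢, IsClosed G ∧ Convex ℝ G ∧ G ⊆ C := by
    rintro G (rfl | hG)
    · exact ⟨hC, hconv, subset_rfl⟩
    · exact IsFlatPart.isClosed_convex_subset hC hG
  have hdense (G : Set (Space d)) : ∃ D : Set (Space d), D ⊆ G ∧ D.Countable ∧ G ⊆ closure D := by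
    exact (TopologicalSpace.IsSeparable.of_separableSpace G).exists_countable_dense_subset
  choose D hDG hDc hD using hdense
  let V : Set (Space d) := ⋃ G ∈ 𝒢, image2 (fun a b => b - a) (D G) (D G)
  have hV : V.Countable := h𝒢.biUnion fun G _ => (hDc G).image2 (hDc G) _
  let 𝒜 : Set (Set (Space d)) :=
    image2 (fun U G => U ∩ G) (TopologicalSpace.countableBasis (Space d)) 𝒢
  have h𝒜 : 𝒜.Countable := (TopologicalSpace.countable_countableBasis _).image2 h𝒢 _
  have h𝒜m : ∀ A ∈ 𝒜, MeasurableSet A := by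
    rintro _ ⟨U, hU, G, hG, rfl⟩
    exact (TopologicalSpace.isOpen_of_mem_countableBasis hU).measurableSet.inter
      (h𝒢' G hG).1.measurableSet
  have hdisp {A : Set (Space d)} (hA : MeasurableSet A) :
      MeasurableSet {p : Space d × Space d | p.2 - p.1 ∈ A} := hA.preimage (by fun_prop)
  -- Points of positive density that send mass along displacements in `A`; recurrence is applied to
  -- these sets.
  let S : Set (Space d) → Set (Space d) := fun A => {x | ρ x ≠ 0 ∧ K x {y | y - x ∈ A} ≠ 0}
  have hS : ∀ A ∈ 𝒜, MeasurableSet (S A) := fun A hA =>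
    (measurableSet_eq_fun hρ measurable_const).compl.inter (measurableSet_eq_fun
      (Kernel.measurable_kernel_prodMk_left (hdisp (h𝒜m A hA))) measurable_const).compl
  -- the properties of almost every point
  have ae1 : ∀ᵐ x, ∀ A ∈ 𝒜, ∀ v ∈ V, x ∈ S A →
      ∃ᶠ n : ℕ in atTop, x + (1 / ((n : ℝ) + 1)) • v ∈ S A :=
    (ae_ball_iff h𝒜).2 fun A hA => (ae_ball_iff hV).2 fun v _ =>
      ae_frequently_add_smul_mem (hS A hA) v
  have ae2 : ∀ᵐ x, ∀ v ∈ V, ∀ n : ℕ,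
      min (ρ x) (ρ (x + (1 / ((n : ℝ) + 1)) • v)) ≠ 0 →
      ∀ᵐ y ∂(K x).prod (K (x + (1 / ((n : ℝ) + 1)) • v)),
        cost C x y.1 + cost C (x + (1 / ((n : ℝ) + 1)) • v) y.2 ≤
          cost C x y.2 + cost C (x + (1 / ((n : ℝ) + 1)) • v) y.1 :=
    (ae_ball_iff hV).2 fun v _ => ae_all_iff.2 fun n => hπ.ae_ae_cost_add_le hC hfin hρ hK _
  have ae3 : ∀ᵐ x ∂f₀, ∀ᵐ y ∂K x, y - x ∈ C := by
    refine Measure.ae_ae_of_ae_compProd (p := fun p : Space d × Space d => p.2 - p.1 ∈ C) ?_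
    rw [← hK']
    filter_upwards [ae_lt_top (measurable_cost hC) hfin.ne] with p hp
    by_contra h
    simp [cost, h] at hp
  have ae4 : ∀ᵐ x ∂f₀, ρ x ≠ 0 := by
    rw [← hρf, ae_withDensity_iff hρ]
    exact Eventually.of_forall fun x h => h
  -- the conditional measures are Dirac masses
  have hdirac : ∀ᵐ x ∂f₀, ∃ z, ∀ᵐ y ∂K x, y = z := by
    filter_upwards [hf₀.ae_le ae1, hf₀.ae_le ae2, ae3, ae4] with x hx1 hx2 hx3 hx4
    have hcharge : ∀ᵐ y ∂K x, ∀ A ∈ 𝒜, y - x ∈ A → K x {y | y - x ∈ A} ≠ 0 := by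
      refine (ae_ball_iff h𝒜).2 fun A _ => ?_
      by_cases h0 : K x {y | y - x ∈ A} = 0
      · filter_upwards [measure_eq_zero_iff_ae_notMem.1 h0] with y hy h
        exact absurd h hy
      · exact Eventually.of_forall fun _ _ => h0
    obtain ⟨z, hz3, hzc⟩ := (hx3.and hcharge).exists
    refine ⟨z, ?_⟩
    filter_upwards [hx3, hcharge] with y hy3 hyc
    by_contra hyz
    have hpq : y - x ≠ z - x := fun h => hyz (sub_left_injective h)
    obtain ⟨G, hGC, hpG, hqG, hmid⟩ :=
      exists_flatPart_midpoint_mem_intrinsicInterior hC hconv hy3 hz3 hpq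
    have hG : G ∈ 𝒢 := hGC
    obtain ⟨-, hGconv, hGsub⟩ := h𝒢' G hG
    obtain ⟨a, ha, b, hb, δ, hδ, τ, hτ, hmain⟩ :=
      exists_direction_sq_norm_add_lt hGconv (hDG G) (hD G) hpG hqG hpq hmid
    have hv : b - a ∈ V := mem_biUnion hG ⟨a, ha, b, hb, rfl⟩
    have hbasis := TopologicalSpace.isBasis_countableBasis (Space d)
    obtain ⟨U, hU, hpU, hUδ⟩ := hbasis.exists_subset_of_mem_open (Metric.mem_ball_self hδ)
      (Metric.isOpen_ball (x := y - x))
    obtain ⟨U', hU', hqU, hUδ'⟩ := hbasis.exists_subset_of_mem_open (Metric.mem_ball_self hδ)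
      (Metric.isOpen_ball (x := z - x))
    have hA : U ∩ G ∈ 𝒜 := ⟨U, hU, G, hG, rfl⟩
    have hA' : U' ∩ G ∈ 𝒜 := ⟨U', hU', G, hG, rfl⟩
    have hsmall : ∀ᶠ n : ℕ in atTop, 1 / ((n : ℝ) + 1) < τ :=
      tendsto_one_div_add_atTop_nhds_zero_nat.eventually (gt_mem_nhds hτ)
    obtain ⟨n, hnS, hnτ⟩ :=
      ((hx1 _ hA _ hv ⟨hx4, hyc _ hA ⟨hpU, hpG⟩⟩).and_eventually hsmall).exists
    have ht0 : 0 < 1 / ((n : ℝ) + 1) := Nat.one_div_pos_of_nat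
    have hmono := hx2 _ hv n (lt_min (pos_iff_ne_zero.2 hx4) (pos_iff_ne_zero.2 hnS.1)).ne'
    set t := 1 / ((n : ℝ) + 1)
    set v := b - a
    -- The exchanged pair: from `x` a displacement near `z - x`, from `x + t • v` one near `y - x`.
    have hpos : ((K x).prod (K (x + t • v)))
        ({y | y - x ∈ U' ∩ G} ×ˢ {y | y - (x + t • v) ∈ U ∩ G}) ≠ 0 := by
      rw [Measure.prod_prod]
      exact mul_ne_zero (hzc _ hA' ⟨hqU, hqG⟩) hnS.2
    obtain ⟨⟨y₁, y₂⟩, ⟨h1, h2⟩, hle⟩ :=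
      ((frequently_ae_mem_iff.2 hpos).and_eventually hmono).exists
    obtain ⟨m1, m2, m3⟩ := hmain t ht0 hnτ (y₂ - (x + t • v)) h2.2 (y₁ - x) h1.2
      (hUδ h2.1) (hUδ' h1.1)
    have r1 : y₂ - (x + t • v) + t • v = y₂ - x := by abel
    have r2 : y₁ - x - t • v = y₁ - (x + t • v) := by abel
    rw [r1] at m1 m3
    rw [r2] at m2 m3
    simp only [cost, if_pos (hGsub h1.2), if_pos (hGsub h2.2), if_pos (hGsub m1),
      if_pos (hGsub m2)] at hle
    rw [← ENNReal.ofReal_add (by positivity) (by positivity),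
      ← ENNReal.ofReal_add (by positivity) (by positivity),
      ENNReal.ofReal_le_ofReal_iff (by positivity)] at hle
    linarith
  -- The barycentre recovers the Dirac point measurably; its value where `K x` is not Dirac is
  -- irrelevant.
  have hTm : Measurable fun x => ∫ y, y ∂K x :=
    (stronglyMeasurable_id.integral_kernel (κ := K)).measurable
  refine ⟨fun x => ∫ y, y ∂K x, hTm, ?_⟩
  rw [hK']
  refine (Measure.ae_compProd_iff (measurableSet_eq_fun measurable_snd
    (hTm.comp measurable_fst))).2 ?_
  filter_upwards [hdirac] with x ⟨z, hz⟩
  have : ∫ y, y ∂K x = z := by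
    rw [integral_congr_ae (g := fun _ => z) hz]
    simp
  filter_upwards [hz] with y hy
  exact hy.trans this.symm

/-! ### Uniqueness and the passage from plans to maps -/

/-- A plan concentrated on the graph of `T` is the plan induced by `T`. -/
lemma eq_map_of_ae_eq {f₀ f₁ : Measure (Space d)} {π : Measure (Space d × Space d)}
    (hπ : π ∈ Plans f₀ f₁) {T : Space d → Space d} (hT : Measurable T)
    (h : ∀ᵐ p ∂π, p.2 = T p.1) : π = f₀.map fun x => (x, T x) := by
  rw [← hπ.2.1, Measure.map_map (by fun_prop) measurable_fst]
  conv_lhs => rw [← Measure.map_id (μ := π)]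
  refine Measure.map_congr ?_
  filter_upwards [h] with p hp
  exact Prod.ext rfl hp

lemma map_mem_plans {f₀ f₁ : Measure (Space d)} [IsProbabilityMeasure f₀] {T : Space d → Space d}
    (hT : T ∈ Maps f₀ f₁) : (f₀.map fun x => (x, T x)) ∈ Plans f₀ f₁ := by
  have hm : Measurable fun x => (x, T x) := measurable_id.prodMk hT.1
  refine ⟨Measure.isProbabilityMeasure_map hm.aemeasurable, ?_, ?_⟩
  · rw [Measure.map_map measurable_fst hm]
    exact Measure.map_id
  · rw [Measure.map_map measurable_snd hm]
    exact hT.2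

lemma planCost_map {C : Set (Space d)} (hC : IsClosed C) (f₀ : Measure (Space d))
    {T : Space d → Space d} (hT : Measurable T) :
    planCost C (f₀.map fun x => (x, T x)) = mapCost C f₀ T :=
  lintegral_map (measurable_cost hC) (measurable_id.prodMk hT)

lemma midpoint_mem_plans {f₀ f₁ : Measure (Space d)} {π π' : Measure (Space d × Space d)}
    (hπ : π ∈ Plans f₀ f₁) (hπ' : π' ∈ Plans f₀ f₁) :
    (2⁻¹ : ℝ≥0∞) • π + (2⁻¹ : ℝ≥0∞) • π' ∈ Plans f₀ f₁ := by
  have := hπ.1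
  have := hπ'.1
  refine ⟨⟨by simp [ENNReal.inv_two_add_inv_two]⟩, ?_, ?_⟩
  · rw [Measure.map_add _ _ measurable_fst, Measure.map_smul, Measure.map_smul, hπ.2.1, hπ'.2.1,
      ← add_smul, ENNReal.inv_two_add_inv_two, one_smul]
  · rw [Measure.map_add _ _ measurable_snd, Measure.map_smul, Measure.map_smul, hπ.2.2, hπ'.2.2,
      ← add_smul, ENNReal.inv_two_add_inv_two, one_smul]

/-- The average of the two plans is optimal, so it lives on one graph; both plans then live on that
graph and are induced by the same map. -/
lemma SolvesKantorovich.unique {C : Set (Space d)} (hC : IsClosed C) (hconv : Convex ℝ C)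
    {f₀ f₁ : Measure (Space d)} [IsProbabilityMeasure f₀] (hf₀ : f₀ ≪ volume)
    (hflat : {F | IsFlatPart C F}.Countable) {π π' : Measure (Space d × Space d)}
    (hπ : SolvesKantorovich C f₀ f₁ π) (hfin : planCost C π < ⊤)
    (hπ' : SolvesKantorovich C f₀ f₁ π') : π' = π := by
  have heq : planCost C π' = planCost C π := le_antisymm (hπ'.2 hπ.1) (hπ.2 hπ'.1)
  have hcost : planCost C ((2⁻¹ : ℝ≥0∞) • π + (2⁻¹ : ℝ≥0∞) • π') = planCost C π := by
    have : planCost C ((2⁻¹ : ℝ≥0∞) • π + (2⁻¹ : ℝ≥0∞) • π') =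
        2⁻¹ * planCost C π + 2⁻¹ * planCost C π' := by
      simp [planCost, lintegral_add_measure, lintegral_smul_measure]
    rw [this, heq, ← add_mul, ENNReal.inv_two_add_inv_two, one_mul]
  have hmid : SolvesKantorovich C f₀ f₁ ((2⁻¹ : ℝ≥0∞) • π + (2⁻¹ : ℝ≥0∞) • π') :=
    ⟨midpoint_mem_plans hπ.1 hπ'.1, fun σ hσ => hcost.trans_le (hπ.2 hσ)⟩
  obtain ⟨T, hT, hae⟩ := hmid.exists_map hC hconv hf₀ hflat (hcost ▸ hfin)
  rw [ae_add_measure_iff, Measure.ae_ennreal_smul_measure_iff (by simp),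
    Measure.ae_ennreal_smul_measure_iff (by simp)] at hae
  rw [eq_map_of_ae_eq hπ.1 hT hae.1, eq_map_of_ae_eq hπ'.1 hT hae.2]

end ConstrainedOT

theorem mainTheorem2 (d : ℕ) (C : Set (ConstrainedOT.Space d))
    (hC_closed : IsClosed C) (hC_convex : Convex ℝ C)
    (f₀ f₁ : Measure (ConstrainedOT.Space d))
    [IsProbabilityMeasure f₀] [IsProbabilityMeasure f₁]
    (hf₀ : f₀ ≪ volume)
    (hfinite : ∃ π ∈ ConstrainedOT.Plans f₀ f₁, ConstrainedOT.planCost C π < ⊤)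
    (hflat : {F | ConstrainedOT.IsFlatPart C F}.Countable) :
    (∃! π, ConstrainedOT.SolvesKantorovich C f₀ f₁ π) ∧
    (∃ T, ConstrainedOT.SolvesMonge C f₀ f₁ T ∧
      ∀ S, ConstrainedOT.SolvesMonge C f₀ f₁ S → S =ᵐ[f₀] T) := by
  open ConstrainedOT in
  obtain ⟨π, hπ, hfin⟩ := exists_solvesKantorovich hC_closed f₀ f₁ hfinite
  have huniq (π' : Measure (Space d × Space d)) (hπ' : SolvesKantorovich C f₀ f₁ π') : π' = π :=
    SolvesKantorovich.unique hC_closed hC_convex hf₀ hflat hπ hfin hπ'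
  refine ⟨⟨π, hπ, huniq⟩, ?_⟩
  obtain ⟨T, hT, hae⟩ := hπ.exists_map hC_closed hC_convex hf₀ hflat hfin
  have hπT := eq_map_of_ae_eq hπ.1 hT hae
  have hTmaps : T ∈ Maps f₀ f₁ := by
    refine ⟨hT, ?_⟩
    rw [← hπ.1.2.2, hπT, Measure.map_map measurable_snd (by fun_prop)]
    rfl
  have hTcost : mapCost C f₀ T = planCost C π := by rw [hπT, planCost_map hC_closed f₀ hT]
  refine ⟨T, ⟨hTmaps, fun S hS => ?_⟩, fun S hS => ?_⟩
  · show mapCost C f₀ T ≤ mapCost C f₀ S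
    rw [hTcost, ← planCost_map hC_closed f₀ hS.1]
    exact hπ.2 (map_mem_plans hS)
  -- The plan induced by `S` costs no more than `π`, so it is `π` itself and the graph of `T`
  -- carries it.
  · have hSπ : (f₀.map fun x => (x, S x)) = π := by
      refine huniq _ ⟨map_mem_plans hS.1, fun σ hσ => ?_⟩
      show planCost C (f₀.map fun x => (x, S x)) ≤ planCost C σ
      rw [planCost_map hC_closed f₀ hS.1.1]
      exact ((hS.2 hTmaps).trans_eq hTcost).trans (hπ.2 hσ)
    rw [← hSπ] at hae
    exact ae_of_ae_map (measurable_id.prodMk hS.1.1).aemeasurable hae
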